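/- Let $R$ be a commutative ring. Call $R$ Tor-persistent if every finitely generated $R$-module $M$ for which there is an integer $n$ with $\operatorname{Tor}_i^R(M,M)=0$ for all $i\ge n$ has finite projective dimension over $R$ (the zero module counts as having finite projective dimension). Proposition. A commutative noetherian ring $R$ is Tor-persistent if and only if for every maximal ideal $\mathfrak m$ of $R$ the localization $R_{\mathfrak m}$ is Tor-persistent. -/

import Mathlib

universe u

open CategoryTheory

/-- A commutative ring `R` is `Tor`-persistent if every finitely generated `R`-module `M` with
`Tor_i^R(M, M) = 0` for all `i ≫ 0` has finite projective dimension. Every finitely generated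
`R`-module is isomorphic to one in the universe of `R`, so it suffices to quantify over these.
The projective dimension takes values in `WithBot ℕ∞`, with value `⊥` exactly at zero modules. -/
def IsTorPersistent (R : Type u) [CommRing R] : Prop :=
  ∀ M : ModuleCat.{u} R, Module.Finite R M →
    (∃ n : ℕ, ∀ i : ℕ, n ≤ i →
      Limits.IsZero (((Tor (ModuleCat.{u} R) i).obj M).obj M)) →
    projectiveDimension M < ⊤

open scoped TensorProduct
open Abelian

/-! Write `M*` for the Pontryagin dual. Since ℚ/ℤ is an injective cogenerator, `Tor_i(M, N) = 0` iff
`Ext^i(N, M*) = 0` for `i > 0` (`isZero_tor_succ_iff`), so Tor is handled through the long exact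
sequences of Ext.

Local to global: Tor vanishing localizes, so every `M_𝔪` has finite projective dimension. The loci
`pd ≤ n` are open and increasing, and quasi-compactness of the spectrum gives a uniform bound.

Global to local: a finitely generated `R_𝔪`-module is some `M_𝔪`, but `Tor(M, M)` may survive at
other maximal ideals. Replace `M` by the kernel of `(π, x) : F ⊕ M → M`, for `x` running through
generators of `𝔪` (a Koszul construction within modules). Tor vanishing at `𝔪` persists. At any
other maximal ideal some generator is invertible, so the result `E` is projective there. Hence `pd E
< ∞`, and Nakayama brings finiteness back from `E_𝔪` to `M_𝔪`
(`ConeKernel.projectiveDimension_lt_top`). -/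

/-! ### Pontryagin duality between Tor and Ext -/

theorem CharacterModule.exact_dual_iff {R : Type*} [CommRing R] {A B C : Type*} [AddCommGroup A]
    [AddCommGroup B] [AddCommGroup C] [Module R A] [Module R B] [Module R C]
    (f : A →ₗ[R] B) (g : B →ₗ[R] C) (h : g ∘ₗ f = 0) :
    Function.Exact f g ↔
      ∀ c : CharacterModule B, dual f c = 0 → ∃ d : CharacterModule C, dual g d = c := by
  constructor
  · intro hex c hc
    -- By exactness `c` kills the kernel of `g`, so it descends to the range of `g`; injectivity of
    -- ℚ/ℤ extends it to `C`.
    have hk : g.rangeRestrict.toAddMonoidHom.ker ≤ AddMonoidHom.ker (G := B) c := by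
      intro y hy
      obtain ⟨x, rfl⟩ := (hex y).1 (congrArg Subtype.val hy)
      exact DFunLike.congr_fun hc x
    obtain ⟨d, hd⟩ := dual_surjective_of_injective g.range.subtype Subtype.val_injective
      (AddMonoidHom.liftOfSurjective _ g.surjective_rangeRestrict ⟨c, hk⟩)
    refine ⟨d, DFunLike.ext _ _ fun y ↦ ?_⟩
    have h1 := DFunLike.congr_fun hd (g.rangeRestrict y)
    exact h1.trans (AddMonoidHom.liftOfRightInverse_comp_apply _ _ _ ⟨c, hk⟩ y)
  · intro H y
    constructor
    · intro hy
      by_contra hn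
      have : (LinearMap.range f).mkQ y ≠ 0 := by
        simpa using hn
      obtain ⟨c, hc⟩ := CharacterModule.exists_character_apply_ne_zero_of_ne_zero this
      obtain ⟨d, hd⟩ := H (dual (LinearMap.range f).mkQ c) (by
        rw [← LinearMap.comp_apply, ← dual_comp, LinearMap.range_mkQ_comp, dual_zero]; rfl)
      apply hc
      have h1 : d (g y) = c ((LinearMap.range f).mkQ y) := DFunLike.congr_fun hd y
      rw [← h1, hy, map_zero]
    · rintro ⟨x, rfl⟩
      exact LinearMap.congr_fun h x

/-- Dualize and apply the adjunction `Hom(B ⊗ M, ℚ/ℤ) = Hom(B, M*)`. -/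
theorem CharacterModule.exact_rTensor_iff {R : Type*} [CommRing R] {A B C : Type*}
    [AddCommGroup A] [AddCommGroup B] [AddCommGroup C] [Module R A] [Module R B] [Module R C]
    (M : Type*) [AddCommGroup M] [Module R M]
    (f : A →ₗ[R] B) (g : B →ₗ[R] C) (h : g ∘ₗ f = 0) :
    Function.Exact (f.rTensor M) (g.rTensor M) ↔
      ∀ c : B →ₗ[R] CharacterModule M, c ∘ₗ f = 0 →
        ∃ d : C →ₗ[R] CharacterModule M, d ∘ₗ g = c := by
  rw [CharacterModule.exact_dual_iff _ _ (by
    rw [← LinearMap.rTensor_comp, h, LinearMap.rTensor_zero])]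
  constructor
  · intro H c hc
    obtain ⟨d, hd⟩ := H (homEquiv c) (by
      apply homEquiv.symm.injective
      rw [map_zero]
      exact hc)
    refine ⟨homEquiv.symm d, ?_⟩
    apply homEquiv.injective
    rw [← hd]
    obtain ⟨d, rfl⟩ := homEquiv.surjective d
    apply homEquiv.symm.injective
    simp only [LinearEquiv.symm_apply_apply]
    rfl
  · intro H c hc
    obtain ⟨d, hd⟩ := H (homEquiv.symm c) (by
      have := congrArg homEquiv.symm hc
      rw [map_zero] at this
      exact this)
    refine ⟨homEquiv d, ?_⟩
    apply homEquiv.symm.injective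
    exact hd

variable {R : Type u} [CommRing R]

/-- The Pontryagin dual `Hom_ℤ(M, ℚ/ℤ)` as an `R`-module. -/
noncomputable abbrev ModuleCat.charDual (M : ModuleCat.{u} R) : ModuleCat.{u} R :=
  ModuleCat.of R (CharacterModule M)

/-- For a projective resolution `P` of `N`, exactness of `P ⊗ M` in degree `i + 1` says by
adjunction that every cocycle `P_{i+1} → M*` is a coboundary. -/
theorem ModuleCat.isZero_tor_succ_iff (M N : ModuleCat.{u} R) (i : ℕ) :
    Limits.IsZero (((Tor (ModuleCat.{u} R) (i + 1)).obj M).obj N) ↔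
      Subsingleton (Ext N M.charDual (i + 1)) := by
  let P := ProjectiveResolution.of N
  have e := P.isoLeftDerivedObj ((MonoidalCategory.tensoringLeft (ModuleCat.{u} R)).obj M) (i + 1)
  have h1 : Limits.IsZero (((Tor (ModuleCat.{u} R) (i + 1)).obj M).obj N) ↔
      Function.Exact ((P.complex.d (i + 2) (i + 1)).hom.rTensor M)
        ((P.complex.d (i + 1) i).hom.rTensor M) := by
    have h2 : Function.Exact ((P.complex.d (i + 2) (i + 1)).hom.rTensor M)
        ((P.complex.d (i + 1) i).hom.rTensor M) ↔
        Function.Exact ((P.complex.d (i + 2) (i + 1)).hom.lTensor M)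
        ((P.complex.d (i + 1) i).hom.lTensor M) :=
      (Function.Exact.iff_of_ladder_linearEquiv (e₁ := TensorProduct.comm R _ _)
        (e₂ := TensorProduct.comm R _ _) (e₃ := TensorProduct.comm R _ _)
        (by ext; simp) (by ext; simp)).symm
    rw [h2, Tor_obj, e.isZero_iff]
    erw [← HomologicalComplex.exactAt_iff_isZero_homology]
    rw [HomologicalComplex.exactAt_iff' _ (i + 2) (i + 1) i (by simp) (by simp),
      ShortComplex.ShortExact.moduleCat_exact_iff_function_exact]
    rfl
  rw [h1, CharacterModule.exact_rTensor_iff]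
  · constructor
    · intro H
      refine subsingleton_of_forall_eq 0 fun α ↦ ?_
      obtain ⟨f, hf, rfl⟩ := P.extMk_surjective α (i + 2) rfl
      rw [P.extMk_eq_zero_iff f (i + 2) rfl hf i rfl]
      obtain ⟨d, hd⟩ := H f.hom (congrArg ModuleCat.Hom.hom hf)
      exact ⟨ModuleCat.ofHom d, ModuleCat.hom_ext hd⟩
    · intro H c hc
      have hf : P.complex.d (i + 2) (i + 1) ≫
          (ModuleCat.ofHom c : P.complex.X (i + 1) ⟶ M.charDual) = 0 := ModuleCat.hom_ext hc
      obtain ⟨g, hg⟩ := (P.extMk_eq_zero_iff _ (i + 2) rfl hf i rfl).1 (Subsingleton.elim _ _)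
      exact ⟨g.hom, congrArg ModuleCat.Hom.hom hg⟩
  · rw [← ModuleCat.hom_comp, P.complex.d_comp_d]; rfl

/-! ### Ext vanishing along short exact sequences and their duals -/

namespace CategoryTheory.ShortComplex.ShortExact

variable {S : ShortComplex (ModuleCat.{u} R)}

theorem subsingleton_ext_X₂_left (hS : S.ShortExact) (Y : ModuleCat.{u} R) (n : ℕ)
    (h₁ : Subsingleton (Ext S.X₁ Y n))
    (h₃ : Subsingleton (Ext S.X₃ Y n)) : Subsingleton (Ext S.X₂ Y n) := by
  refine subsingleton_of_forall_eq 0 fun α ↦ ?_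
  obtain ⟨β, rfl⟩ := Ext.contravariant_sequence_exact₂ hS Y α (Subsingleton.elim _ _)
  rw [Subsingleton.elim β 0, Ext.comp_zero]

theorem subsingleton_ext_X₁_left (hS : S.ShortExact) (Y : ModuleCat.{u} R) (n : ℕ)
    (h₂ : Subsingleton (Ext S.X₂ Y n))
    (h₃ : Subsingleton (Ext S.X₃ Y (n + 1))) : Subsingleton (Ext S.X₁ Y n) := by
  refine subsingleton_of_forall_eq 0 fun α ↦ ?_
  obtain ⟨β, rfl⟩ := Ext.contravariant_sequence_exact₁ hS Y α (add_comm 1 n)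
    (Subsingleton.elim _ _)
  rw [Subsingleton.elim β 0, Ext.comp_zero]

theorem subsingleton_ext_X₃_left (hS : S.ShortExact) (Y : ModuleCat.{u} R) (n : ℕ)
    (h₁ : Subsingleton (Ext S.X₁ Y n))
    (h₂ : Subsingleton (Ext S.X₂ Y (n + 1))) : Subsingleton (Ext S.X₃ Y (n + 1)) := by
  refine subsingleton_of_forall_eq 0 fun α ↦ ?_
  obtain ⟨β, rfl⟩ := Ext.contravariant_sequence_exact₃ hS Y α (Subsingleton.elim _ _)
    (add_comm 1 n)
  rw [Subsingleton.elim β 0, Ext.comp_zero]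

theorem subsingleton_ext_X₂_right (hS : S.ShortExact) (X : ModuleCat.{u} R) (n : ℕ)
    (h₁ : Subsingleton (Ext X S.X₁ n))
    (h₃ : Subsingleton (Ext X S.X₃ n)) : Subsingleton (Ext X S.X₂ n) := by
  refine subsingleton_of_forall_eq 0 fun α ↦ ?_
  obtain ⟨β, rfl⟩ := Ext.covariant_sequence_exact₂ X hS α (Subsingleton.elim _ _)
  rw [Subsingleton.elim β 0, Ext.zero_comp]

theorem subsingleton_ext_X₃_right (hS : S.ShortExact) (X : ModuleCat.{u} R) (n : ℕ)
    (h₂ : Subsingleton (Ext X S.X₂ n))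
    (h₁ : Subsingleton (Ext X S.X₁ (n + 1))) : Subsingleton (Ext X S.X₃ n) := by
  refine subsingleton_of_forall_eq 0 fun α ↦ ?_
  obtain ⟨β, rfl⟩ := Ext.covariant_sequence_exact₃ X hS α rfl (Subsingleton.elim _ _)
  rw [Subsingleton.elim β 0, Ext.zero_comp]

end CategoryTheory.ShortComplex.ShortExact

namespace ModuleCat

theorem subsingleton_ext_of_projective (X Y : ModuleCat.{u} R) [Projective X] (n : ℕ) :
    Subsingleton (Ext X Y (n + 1)) :=
  subsingleton_of_forall_eq 0 fun _ ↦ Ext.eq_zero_of_projective _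

theorem subsingleton_ext_of_injective (X Y : ModuleCat.{u} R) [Injective Y] (n : ℕ) :
    Subsingleton (Ext X Y (n + 1)) :=
  subsingleton_of_forall_eq 0 fun _ ↦ Ext.eq_zero_of_injective _

instance injective_charDual (F : ModuleCat.{u} R) [Projective F] : Injective F.charDual := by
  have : Module.Projective R F := (IsProjective.iff_projective F).2 inferInstance
  have := Module.Flat.iff_characterModule_injective.1 (inferInstance : Module.Flat R F)
  exact Module.injective_object_of_injective_module R _

/-- The short complex of Pontryagin duals. -/
noncomputable def charDualShortComplex (S : ShortComplex (ModuleCat.{u} R)) :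
    ShortComplex (ModuleCat.{u} R) :=
  .mk (X₁ := S.X₃.charDual) (X₂ := S.X₂.charDual) (X₃ := S.X₁.charDual)
    (ofHom (CharacterModule.dual S.g.hom)) (ofHom (CharacterModule.dual S.f.hom)) (by
      rw [← ofHom_comp, ← CharacterModule.dual_comp, ← hom_comp, S.zero, hom_zero,
        CharacterModule.dual_zero]
      rfl)

theorem shortExact_charDualShortComplex {S : ShortComplex (ModuleCat.{u} R)} (hS : S.ShortExact) :
    (charDualShortComplex S).ShortExact where
  exact := by
    rw [ShortComplex.ShortExact.moduleCat_exact_iff_function_exact]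
    intro c
    constructor
    · exact (CharacterModule.exact_dual_iff S.f.hom S.g.hom (by rw [← hom_comp, S.zero]; rfl)).1
        ((ShortComplex.ShortExact.moduleCat_exact_iff_function_exact _).1 hS.exact) c
    · rintro ⟨d, rfl⟩
      exact ConcreteCategory.congr_hom (charDualShortComplex S).zero d
  mono_f := by
    rw [ModuleCat.mono_iff_injective]
    exact CharacterModule.dual_injective_of_surjective _
      ((ModuleCat.epi_iff_surjective _).1 hS.epi_g)
  epi_g := by
    rw [ModuleCat.epi_iff_surjective]
    exact CharacterModule.dual_surjective_of_injective _
      ((ModuleCat.mono_iff_injective _).1 hS.mono_f)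

/-! ### Cones of multiplication by an element -/

/-- Presentation of `E` as the kernel of `(π, x) : F ⊞ M ⟶ M`, with `F` projective and `π` an
epimorphism; up to a shift and a projective summand, `E` is the cone of `x` on `M`. -/
structure ConeKernel (M E : ModuleCat.{u} R) (x : R) where
  F : ModuleCat.{u} R
  B : ModuleCat.{u} R
  i : F ⟶ B
  q : B ⟶ F
  s : M ⟶ B
  r : B ⟶ M
  e : E ⟶ B
  g : B ⟶ M
  projective : Projective F
  i_q : i ≫ q = 𝟙 F
  i_r : i ≫ r = 0
  s_q : s ≫ q = 0
  s_r : s ≫ r = 𝟙 M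
  total : q ≫ i + r ≫ s = 𝟙 B
  s_g : s ≫ g = x • 𝟙 M
  e_g : e ≫ g = 0
  shortExact : (ShortComplex.mk e g e_g).ShortExact

theorem exists_coneKernel [IsNoetherianRing R] (M : ModuleCat.{u} R) [Module.Finite R M] (x : R) :
    ∃ (E : ModuleCat.{u} R) (_ : Module.Finite R E), Nonempty (ConeKernel M E x) := by
  obtain ⟨F, _, _, _, _, f, hf⟩ := Module.exists_finite_presentation R M
  let g : F × M →ₗ[R] M := f.coprod (x • LinearMap.id)
  have hg : Function.Surjective g := fun m ↦ by
    obtain ⟨y, rfl⟩ := hf m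
    exact ⟨(y, 0), by simp [g]⟩
  refine ⟨of R (LinearMap.ker g), inferInstance, ⟨?_⟩⟩
  exact
    { F := of R F
      B := of R (F × M)
      i := ofHom (LinearMap.inl R F M)
      q := ofHom (LinearMap.fst R F M)
      s := ofHom (LinearMap.inr R F M)
      r := ofHom (LinearMap.snd R F M)
      e := ofHom (LinearMap.ker g).subtype
      g := ofHom g
      projective := ModuleCat.projective_of_categoryTheory_projective _
      i_q := rfl
      i_r := rfl
      s_q := rfl
      s_r := rfl
      total := by ext y <;> simp
      s_g := by ext y; simp [g]
      e_g := by ext y; exact y.2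
      shortExact := LinearMap.shortExact_shortComplexKer hg }

namespace ConeKernel

variable {M E : ModuleCat.{u} R} {x : R}

/-- The split short exact sequence `F ⟶ B ⟶ M`. -/
noncomputable def splitComplex (c : ConeKernel M E x) : ShortComplex (ModuleCat.{u} R) :=
  .mk c.i c.r c.i_r

/-- The splitting of `F ⟶ B ⟶ M`. -/
noncomputable def splitting (c : ConeKernel M E x) : c.splitComplex.Splitting where
  r := c.q
  s := c.s
  f_r := c.i_q
  s_g := c.s_r
  id := c.total

/-- Replace `M` by `E` in the first variable along `E → F ⊕ M → M`, then in the second along the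
dual sequence, where `F*` is injective. Both long exact sequences only consult equal or higher
degrees, so the bound `n` is unchanged. -/
theorem subsingleton_ext_self (c : ConeKernel M E x) {n : ℕ}
    (h : ∀ i, n ≤ i → Subsingleton (Ext M M.charDual (i + 1))) :
    ∀ i, n ≤ i → Subsingleton (Ext E E.charDual (i + 1)) := by
  have := c.projective
  have hs := c.splitting.shortExact
  have h1 : ∀ i, n ≤ i → Subsingleton (Ext E M.charDual (i + 1)) := fun i hi ↦
    c.shortExact.subsingleton_ext_X₁_left _ _
      (hs.subsingleton_ext_X₂_left _ _ (subsingleton_ext_of_projective c.F _ i) (h i hi))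
      (h (i + 1) (by lia))
  intro i hi
  exact (shortExact_charDualShortComplex c.shortExact).subsingleton_ext_X₃_right E (i + 1)
    ((shortExact_charDualShortComplex hs).subsingleton_ext_X₂_right E (i + 1) (h1 i hi)
      (subsingleton_ext_of_injective E c.F.charDual i)) (h1 (i + 1) (by lia))

theorem projective_of_projective (c : ConeKernel M E x) [Projective M] : Projective E := by
  have := c.projective
  have hs := c.splitting.shortExact
  rw [projective_iff_subsingleton_ext_one]
  intro Y
  exact c.shortExact.subsingleton_ext_X₁_left _ _
    (hs.subsingleton_ext_X₂_left _ _ (subsingleton_ext_of_projective c.F _ 0)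
      (subsingleton_ext_of_projective M _ 0)) (subsingleton_ext_of_projective M _ 1)

theorem projective_of_isUnit (c : ConeKernel M E x) (hx : IsUnit x) : Projective E := by
  have := c.projective
  obtain ⟨u, rfl⟩ := hx
  have := c.shortExact.mono_f
  -- For a unit `u` the kernel of `(π, u)` is the graph of `-u⁻¹π` over `F`; `j` is `y ↦ (y, -u⁻¹π
  -- y)`.
  let j : c.F ⟶ E := c.shortExact.exact.lift (c.i - c.i ≫ c.g ≫ (((u⁻¹ : Rˣ) : R) • c.s)) (by
    simp [c.s_g, smul_smul])
  have hj : j ≫ c.e = c.i - c.i ≫ c.g ≫ (((u⁻¹ : Rˣ) : R) • c.s) :=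
    c.shortExact.exact.lift_f _ _
  have hr : c.e ≫ c.q ≫ c.i ≫ c.g = - ((u : R) • (c.e ≫ c.r)) := by
    have := congrArg (fun t ↦ c.e ≫ t ≫ c.g) c.total
    simp only [Preadditive.add_comp, Preadditive.comp_add, Category.assoc, c.s_g, c.e_g,
      Category.id_comp, Linear.comp_smul, Category.comp_id] at this
    exact eq_neg_of_add_eq_zero_left this
  refine Retract.projective (Y := c.F) ⟨c.e ≫ c.q, j, ?_⟩
  rw [← cancel_mono c.e, Category.assoc, Category.assoc, hj, Category.id_comp]
  have := congrArg (fun t ↦ c.e ≫ t) c.total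
  simp only [Preadditive.comp_add, Category.comp_id] at this
  refine Eq.trans ?_ this
  simp only [Preadditive.comp_sub, Linear.comp_smul]
  have h2 : c.e ≫ c.q ≫ c.i ≫ c.g ≫ c.s = (c.e ≫ c.q ≫ c.i ≫ c.g) ≫ c.s := by simp
  rw [h2, hr]
  simp [smul_smul]

end ConeKernel

/-! ### Finite projective dimension and Nakayama -/

/-- Finitely generated `Y` suffice because the syzygies of `M` are finitely generated. This
restriction makes `Ext(M, Y)` finitely generated, as Nakayama requires. -/
theorem hasProjectiveDimensionLE_of_subsingleton_ext [IsNoetherianRing R] (n : ℕ)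
    (M : ModuleCat.{u} R) [Module.Finite R M]
    (h : ∀ Y : ModuleCat.{u} R, Module.Finite R Y → Subsingleton (Ext M Y (n + 1))) :
    HasProjectiveDimensionLE M n := by
  induction n generalizing M with
  | zero =>
    obtain ⟨F, _, _, _, _, f, hf⟩ := Module.exists_finite_presentation R M
    have hS := LinearMap.shortExact_shortComplexKer hf
    have : Projective (f.shortComplexKer).X₂ := ModuleCat.projective_of_categoryTheory_projective _
    have := h (f.shortComplexKer).X₁ (inferInstanceAs (Module.Finite R (LinearMap.ker f)))
    -- The identity of the kernel extends to `F`, the obstruction lying in `Ext¹(M, ker f) = 0`; so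
    -- the presentation splits.
    obtain ⟨α, hα⟩ := Ext.contravariant_sequence_exact₁ hS _ (Ext.mk₀ (𝟙 _)) (add_comm 1 0)
      (Subsingleton.elim _ _)
    obtain ⟨r, rfl⟩ := (Ext.mk₀_bijective _ _).2 α
    rw [Ext.mk₀_comp_mk₀] at hα
    have hr := (Ext.mk₀_bijective _ _).1 hα
    let sp := ShortComplex.Splitting.ofExactOfRetraction _ hS.exact r hr hS.epi_g
    rw [← projective_iff_hasProjectiveDimensionLE_zero]
    exact Retract.projective (Y := (f.shortComplexKer).X₂) ⟨sp.s, _, sp.s_g⟩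
  | succ n ih =>
    obtain ⟨F, _, _, _, _, f, hf⟩ := Module.exists_finite_presentation R M
    have hS := LinearMap.shortExact_shortComplexKer hf
    have : Projective (f.shortComplexKer).X₂ := ModuleCat.projective_of_categoryTheory_projective _
    refine (hS.hasProjectiveDimensionLT_X₃_iff n this).2
      (ih (ModuleCat.of R (LinearMap.ker f)) fun Y _ ↦ ?_)
    exact hS.subsingleton_ext_X₁_left Y (n + 1) (subsingleton_ext_of_projective _ _ _)
      (h Y inferInstance)

theorem projectiveDimension_lt_top_iff (M : ModuleCat.{u} R) :
    projectiveDimension M < ⊤ ↔ ∃ n : ℕ, HasProjectiveDimensionLE M n := by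
  rw [lt_top_iff_ne_top, projectiveDimension_ne_top_iff]

theorem ConeKernel.projectiveDimension_lt_top [IsNoetherianRing R] {M E : ModuleCat.{u} R} {x : R}
    (c : ConeKernel M E x) [Module.Finite R M] (hx : x ∈ (⊥ : Ideal R).jacobson)
    (h : projectiveDimension E < ⊤) : projectiveDimension M < ⊤ := by
  rw [projectiveDimension_lt_top_iff] at h ⊢
  obtain ⟨n, hn⟩ := h
  refine ⟨n, hasProjectiveDimensionLE_of_subsingleton_ext n M fun Y _ ↦ ?_⟩
  rw [← Submodule.subsingleton_iff R, ← subsingleton_iff_bot_eq_top, eq_comm]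
  refine Submodule.eq_bot_of_le_smul_of_le_jacobson_bot (Ideal.span {x}) ⊤ Module.Finite.fg_top
    ?_ (by simpa [Ideal.span_le] using hx)
  intro α _
  -- The pullback of `α` to `F ⊕ M` dies in `Ext^{n+1}(E, Y) = 0`, so it comes from some `β` along
  -- `(π, x)`. Restricting to the summand `M` gives `α = xβ`, hence `Ext = x Ext`.
  obtain ⟨β, hβ⟩ := Ext.contravariant_sequence_exact₂ c.shortExact Y
    ((Ext.mk₀ c.r).comp α (zero_add _))
    ((HasProjectiveDimensionLT.subsingleton E (n + 1) (n + 1) le_rfl Y).elim _ _)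
  have : α = x • β := by
    have := congrArg (fun γ ↦ (Ext.mk₀ c.s).comp γ (zero_add _)) hβ
    simp only [Ext.mk₀_comp_mk₀_assoc, c.s_g, c.s_r, Ext.mk₀_id_comp, Ext.mk₀_smul,
      Ext.smul_comp] at this
    exact this.symm
  rw [this]
  exact Submodule.smul_mem_smul (Ideal.mem_span_singleton_self x) trivial

/-- The image of a kernel presentation under an exact functor preserving projectives. -/
noncomputable def ConeKernel.map {M E : ModuleCat.{u} R} {x : R} (c : ConeKernel M E x)
    {A : Type u} [CommRing A] (L : ModuleCat.{u} R ⥤ ModuleCat.{u} A) [L.Additive]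
    [Limits.PreservesFiniteLimits L] [Limits.PreservesFiniteColimits L]
    [L.PreservesProjectiveObjects] {y : A} (h : L.map (x • 𝟙 M) = y • 𝟙 (L.obj M)) :
    ConeKernel (L.obj M) (L.obj E) y where
  F := L.obj c.F
  B := L.obj c.B
  i := L.map c.i
  q := L.map c.q
  s := L.map c.s
  r := L.map c.r
  e := L.map c.e
  g := L.map c.g
  projective := have := c.projective; L.projective_obj _
  i_q := by rw [← L.map_comp, c.i_q, L.map_id]
  i_r := by rw [← L.map_comp, c.i_r, L.map_zero]
  s_q := by rw [← L.map_comp, c.s_q, L.map_zero]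
  s_r := by rw [← L.map_comp, c.s_r, L.map_id]
  total := by rw [← L.map_comp, ← L.map_comp, ← L.map_add, c.total, L.map_id]
  s_g := by rw [← L.map_comp, c.s_g, h]
  e_g := by rw [← L.map_comp, c.e_g, L.map_zero]
  shortExact := c.shortExact.map_of_exact L

/-! ### Localization of Ext vanishing -/

theorem localizedModuleFunctor_map_smul_id (S : Submonoid R) (M : ModuleCat.{u} R) (x : R) :
    (localizedModuleFunctor.{u} S).map (x • 𝟙 M) =
      algebraMap R (Localization S) x • 𝟙 ((localizedModuleFunctor.{u} S).obj M) := by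
  change localizedModuleMap S (x • 𝟙 M) =
    algebraMap R (Localization S) x • 𝟙 (M.localizedModule S)
  refine hom_ext ((LinearMap.restrictScalars_injective R) ?_)
  apply IsLocalizedModule.linearMap_ext S (M.localizedModuleMkLinearMap S)
    (M.localizedModuleMkLinearMap S)
  refine (IsLocalizedModule.map_comp S (M.localizedModuleMkLinearMap S)
    (M.localizedModuleMkLinearMap S) (x • 𝟙 M : M ⟶ M).hom).trans ?_
  ext m
  exact (map_smul (M.localizedModuleMkLinearMap S) x m).trans
    (algebraMap_smul (Localization S) x (M.localizedModuleMkLinearMap S m)).symm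

/-- Both sides say that every map `X₁ → M*` extends to `X₂`. Since duals do not commute with
localization, the tensor side is the one that can be localized. -/
theorem subsingleton_ext_charDual_one_iff {S : ShortComplex (ModuleCat.{u} R)} (hS : S.ShortExact)
    [Projective S.X₂] (M : ModuleCat.{u} R) :
    Subsingleton (Ext S.X₃ M.charDual 1) ↔ Function.Injective (S.f.hom.rTensor M) := by
  rw [rTensor_injective_iff_lcomp_surjective]
  constructor
  · intro _ f
    obtain ⟨α, hα⟩ := Ext.contravariant_sequence_exact₁ hS M.charDual (Ext.mk₀ (ofHom f))
      (add_comm 1 0) (Subsingleton.elim _ _)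
    obtain ⟨r, rfl⟩ := (Ext.mk₀_bijective _ _).2 α
    rw [Ext.mk₀_comp_mk₀] at hα
    exact ⟨r.hom, congrArg Hom.hom ((Ext.mk₀_bijective _ _).1 hα)⟩
  · intro H
    refine subsingleton_of_forall_eq 0 fun α ↦ ?_
    obtain ⟨β, rfl⟩ := Ext.contravariant_sequence_exact₃ hS M.charDual α
      (Ext.eq_zero_of_projective _) (add_comm 1 0)
    obtain ⟨f, rfl⟩ := (Ext.mk₀_bijective _ _).2 β
    obtain ⟨g, hg⟩ := H f.hom
    have : f = S.f ≫ ofHom g := hom_ext hg.symm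
    rw [this, ← Ext.mk₀_comp_mk₀, hS.extClass_comp_assoc]

theorem subsingleton_ext_succ_iff {S : ShortComplex (ModuleCat.{u} R)} (hS : S.ShortExact)
    [Projective S.X₂] (Y : ModuleCat.{u} R) (n : ℕ) :
    Subsingleton (Ext S.X₃ Y (n + 2)) ↔ Subsingleton (Ext S.X₁ Y (n + 1)) :=
  ⟨hS.subsingleton_ext_X₁_left Y _ (subsingleton_ext_of_projective _ _ _),
    fun h ↦ hS.subsingleton_ext_X₃_left Y _ h (subsingleton_ext_of_projective _ _ _)⟩

theorem injective_rTensor_localizedModuleMap_iff (S : Submonoid R) {K F : ModuleCat.{u} R}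
    (f : K ⟶ F) (M : ModuleCat.{u} R) :
    Function.Injective ((localizedModuleMap S f).hom.rTensor (M.localizedModule S)) ↔
    Function.Injective (IsLocalizedModule.map S
      (TensorProduct.map (K.localizedModuleMkLinearMap S) (M.localizedModuleMkLinearMap S))
      (TensorProduct.map (F.localizedModuleMkLinearMap S) (M.localizedModuleMkLinearMap S))
      (f.hom.rTensor M)) := by
  let f' := IsLocalizedModule.map S (K.localizedModuleMkLinearMap S)
    (F.localizedModuleMkLinearMap S) f.hom
  have h1 : IsLocalizedModule.map S
      (TensorProduct.map (K.localizedModuleMkLinearMap S) (M.localizedModuleMkLinearMap S))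
      (TensorProduct.map (F.localizedModuleMkLinearMap S) (M.localizedModuleMkLinearMap S))
      (f.hom.rTensor M) = f'.rTensor (M.localizedModule S) := by
    apply IsLocalizedModule.linearMap_ext S
      (TensorProduct.map (K.localizedModuleMkLinearMap S) (M.localizedModuleMkLinearMap S))
      (TensorProduct.map (F.localizedModuleMkLinearMap S) (M.localizedModuleMkLinearMap S))
    rw [IsLocalizedModule.map_comp]
    ext k m
    simp [f']
  rw [h1]
  -- Between localized modules, tensoring over `R` and over the localization agree.
  let eK := IsLocalization.moduleTensorEquiv S (Localization S) (K.localizedModule S)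
    (M.localizedModule S)
  let eF := IsLocalization.moduleTensorEquiv S (Localization S) (F.localizedModule S)
    (M.localizedModule S)
  have h2 : ∀ z, eF ((localizedModuleMap S f).hom.rTensor (M.localizedModule S) z) =
      f'.rTensor (M.localizedModule S) (eK z) := by
    intro z
    induction z with
    | zero => simp
    | add a b ha hb => simp only [map_add, ha, hb]
    | tmul a b => rfl
  have h3 : (eF ∘ ((localizedModuleMap S f).hom.rTensor (M.localizedModule S))) =
      f'.rTensor (M.localizedModule S) ∘ eK := funext h2
  rw [← EquivLike.injective_comp eK, ← h3, EquivLike.comp_injective]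

theorem injective_rTensor_localizedModuleMap (S : Submonoid R) {K F : ModuleCat.{u} R}
    (f : K ⟶ F) (M : ModuleCat.{u} R) (h : Function.Injective (f.hom.rTensor M)) :
    Function.Injective ((localizedModuleMap S f).hom.rTensor (M.localizedModule S)) :=
  (injective_rTensor_localizedModuleMap_iff S f M).2 (IsLocalizedModule.map_injective S _ _ _ h)

theorem injective_rTensor_of_localizedModuleMap {K F : ModuleCat.{u} R}
    (f : K ⟶ F) (M : ModuleCat.{u} R) (h : ∀ (P : Ideal R) [P.IsMaximal], Function.Injective
      ((localizedModuleMap P.primeCompl f).hom.rTensor (M.localizedModule P.primeCompl))) :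
    Function.Injective (f.hom.rTensor M) :=
  injective_of_isLocalized_maximal _
    (fun P _ ↦ TensorProduct.map (K.localizedModuleMkLinearMap P.primeCompl)
      (M.localizedModuleMkLinearMap P.primeCompl)) _
    (fun P _ ↦ TensorProduct.map (F.localizedModuleMkLinearMap P.primeCompl)
      (M.localizedModuleMkLinearMap P.primeCompl)) _
    fun P _ ↦ (injective_rTensor_localizedModuleMap_iff P.primeCompl f M).1 (h P)

/-- Dimension shifting in `N` reduces to degree one, where localization preserves injectivity. -/
theorem subsingleton_ext_charDual_localizedModule (S : Submonoid R) (M N : ModuleCat.{u} R)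
    (n : ℕ) (h : Subsingleton (Ext N M.charDual (n + 1))) :
    Subsingleton (Ext ((localizedModuleFunctor.{u} S).obj N)
      ((localizedModuleFunctor.{u} S).obj M).charDual (n + 1)) := by
  have hS := N.shortExact_projectiveShortComplex
  have hL := hS.map_of_exact (localizedModuleFunctor.{u} S)
  have : Projective N.projectiveShortComplex.X₂ := projective_of_categoryTheory_projective _
  have : Projective (N.projectiveShortComplex.map (localizedModuleFunctor.{u} S)).X₂ :=
    (localizedModuleFunctor.{u} S).projective_obj _
  induction n generalizing N with
  | zero =>
    exact (subsingleton_ext_charDual_one_iff hL _).2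
      (injective_rTensor_localizedModuleMap S _ _ ((subsingleton_ext_charDual_one_iff hS M).1 h))
  | succ n ih =>
    exact (subsingleton_ext_succ_iff hL _ n).2 (ih _ ((subsingleton_ext_succ_iff hS _ n).1 h)
      (shortExact_projectiveShortComplex _)
      ((shortExact_projectiveShortComplex _).map_of_exact _)
      (projective_of_categoryTheory_projective _) ((localizedModuleFunctor.{u} S).projective_obj _))

theorem subsingleton_ext_charDual_of_localizedModule (M N : ModuleCat.{u} R) (n : ℕ)
    (h : ∀ 𝔪 : MaximalSpectrum R, Subsingleton
      (Ext ((localizedModuleFunctor.{u} 𝔪.asIdeal.primeCompl).obj N)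
        ((localizedModuleFunctor.{u} 𝔪.asIdeal.primeCompl).obj M).charDual (n + 1))) :
    Subsingleton (Ext N M.charDual (n + 1)) := by
  induction n generalizing N with
  | zero =>
    have hS := N.shortExact_projectiveShortComplex
    have : Projective N.projectiveShortComplex.X₂ := projective_of_categoryTheory_projective _
    refine (subsingleton_ext_charDual_one_iff hS M).2 ?_
    refine injective_rTensor_of_localizedModuleMap _ _ fun P hP ↦ ?_
    have hL := hS.map_of_exact (localizedModuleFunctor.{u} P.primeCompl)
    have : Projective (N.projectiveShortComplex.map (localizedModuleFunctor.{u} P.primeCompl)).X₂ :=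
      (localizedModuleFunctor.{u} P.primeCompl).projective_obj _
    exact (subsingleton_ext_charDual_one_iff hL _).1 (h ⟨P, hP⟩)
  | succ n ih =>
    have hS := N.shortExact_projectiveShortComplex
    have : Projective N.projectiveShortComplex.X₂ := projective_of_categoryTheory_projective _
    refine (subsingleton_ext_succ_iff hS _ n).2 (ih _ fun 𝔪 ↦ ?_)
    have hL := hS.map_of_exact (localizedModuleFunctor.{u} 𝔪.asIdeal.primeCompl)
    have : Projective
        (N.projectiveShortComplex.map (localizedModuleFunctor.{u} 𝔪.asIdeal.primeCompl)).X₂ :=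
      (localizedModuleFunctor.{u} 𝔪.asIdeal.primeCompl).projective_obj _
    exact (subsingleton_ext_succ_iff hL _ n).1 (h 𝔪)

/-! ### Projective dimension on the spectrum -/

/-- For `n = 0` this is the free locus, finitely generated projectives over local rings being free;
passing to a syzygy lowers `n`. -/
theorem isOpen_setOf_hasProjectiveDimensionLE_localizedModule [IsNoetherianRing R]
    (M : ModuleCat.{u} R) [Module.Finite R M] (n : ℕ) :
    IsOpen {p : PrimeSpectrum R |
      HasProjectiveDimensionLE (M.localizedModule p.asIdeal.primeCompl) n} := by
  induction n generalizing M with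
  | zero =>
    have := Module.finitePresentation_of_finite R M
    convert Module.isOpen_freeLocus (R := R) (M := M) using 1
    ext p
    have : Module.Finite (Localization p.asIdeal.primeCompl)
        (M.localizedModule p.asIdeal.primeCompl) :=
      Module.Finite.of_isLocalizedModule p.asIdeal.primeCompl
        (M.localizedModuleMkLinearMap p.asIdeal.primeCompl)
    rw [Set.mem_ofPred_eq, ← projective_iff_hasProjectiveDimensionLE_zero,
      ← IsProjective.iff_projective, Module.mem_freeLocus_of_isLocalization p
        (Localization p.asIdeal.primeCompl) (M.localizedModule p.asIdeal.primeCompl)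
        (M.localizedModuleMkLinearMap p.asIdeal.primeCompl)]
    have : IsLocalRing (Localization p.asIdeal.primeCompl) :=
      inferInstanceAs (IsLocalRing (Localization.AtPrime p.asIdeal))
    exact ⟨fun _ ↦ Module.free_of_flat_of_isLocalRing, fun _ ↦ Module.Projective.of_free⟩
  | succ n ih =>
    obtain ⟨F, _, _, _, _, f, hf⟩ := Module.exists_finite_presentation R M
    have hS := LinearMap.shortExact_shortComplexKer hf
    have : Projective (f.shortComplexKer).X₂ := ModuleCat.projective_of_categoryTheory_projective _
    convert ih (ModuleCat.of R (LinearMap.ker f)) using 1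
    ext p
    exact (hS.map_of_exact (localizedModuleFunctor.{u} p.asIdeal.primeCompl))
      |>.hasProjectiveDimensionLT_X₃_iff n ((localizedModuleFunctor.{u} _).projective_obj _)

/-- Over a noetherian ring, a finitely generated module whose localizations at maximal ideals all
have finite projective dimension has finite projective dimension (Bass–Murthy). -/
theorem projectiveDimension_lt_top_of_localizedModule [IsNoetherianRing R]
    (M : ModuleCat.{u} R) [Module.Finite R M]
    (h : ∀ 𝔪 : MaximalSpectrum R,
      projectiveDimension (M.localizedModule 𝔪.asIdeal.primeCompl) < ⊤) :
    projectiveDimension M < ⊤ := by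
  let U : ℕ → Set (PrimeSpectrum R) := fun n ↦ {p |
    HasProjectiveDimensionLE (M.localizedModule p.asIdeal.primeCompl) n}
  have hU : ∀ n, IsOpen (U n) := M.isOpen_setOf_hasProjectiveDimensionLE_localizedModule
  have hmono : Monotone U := fun a b hab p hp ↦
    have : HasProjectiveDimensionLE (M.localizedModule p.asIdeal.primeCompl) a := hp
    hasProjectiveDimensionLT_of_ge _ (a + 1) (b + 1) (by lia)
  -- Open sets are stable under generization, so covering the maximal ideals covers every prime
  -- below them.
  obtain ⟨n, hn⟩ := isCompact_univ.elim_directed_cover U hU (fun p _ ↦ by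
    obtain ⟨m, hm, hpm⟩ := p.asIdeal.exists_le_maximal p.isPrime.ne_top
    obtain ⟨n, hn⟩ := (projectiveDimension_lt_top_iff _).1 (h ⟨m, hm⟩)
    exact Set.mem_iUnion.2 ⟨n, ((PrimeSpectrum.le_iff_specializes p ⟨m, hm.isPrime⟩).1
      hpm).mem_open (hU n) hn⟩) hmono.directed_le
  exact (projectiveDimension_lt_top_iff _).2 ⟨n,
    (hasProjectiveDimensionLE_iff_forall_primeSpectrum n M).2 fun p ↦ hn (Set.mem_univ p)⟩

/-! ### Iterated cones and lifting modules from a localization -/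

theorem finite_localizedModule (M : ModuleCat.{u} R) [Module.Finite R M] (S : Submonoid R) :
    Module.Finite (Localization S) (M.localizedModule S) :=
  Module.Finite.of_isLocalizedModule S (M.localizedModuleMkLinearMap S)

/-- Iterating `ConeKernel` along a list of elements of a maximal ideal produces a module that is
projective wherever one of the elements is inverted. -/
theorem exists_iterated_coneKernel [IsNoetherianRing R] (𝔪 : Ideal R) [𝔪.IsPrime] (l : List R)
    (hl : ∀ x ∈ l, x ∈ 𝔪) (M : ModuleCat.{u} R) [Module.Finite R M] :
    ∃ (E : ModuleCat.{u} R) (_ : Module.Finite R E),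
      (∀ n, (∀ i, n ≤ i → Subsingleton (Ext (M.localizedModule 𝔪.primeCompl)
          (M.localizedModule 𝔪.primeCompl).charDual (i + 1))) →
        ∀ i, n ≤ i → Subsingleton (Ext (E.localizedModule 𝔪.primeCompl)
          (E.localizedModule 𝔪.primeCompl).charDual (i + 1))) ∧
      (∀ S : Submonoid R, Projective (M.localizedModule S) → Projective (E.localizedModule S)) ∧
      (∀ x ∈ l, ∀ S : Submonoid R, x ∈ S → Projective (E.localizedModule S)) ∧
      (projectiveDimension (E.localizedModule 𝔪.primeCompl) < ⊤ →
        projectiveDimension (M.localizedModule 𝔪.primeCompl) < ⊤) := by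
  induction l generalizing M with
  | nil => exact ⟨M, inferInstance, fun _ h ↦ h, fun _ h ↦ h, by simp, id⟩
  | cons x l ih =>
    obtain ⟨K, _, ⟨c⟩⟩ := exists_coneKernel M x
    obtain ⟨E, hE, h₁, h₂, h₃, h₄⟩ := ih (fun y hy ↦ hl y (List.mem_cons_of_mem _ hy)) K
    have cS (S : Submonoid R) :=
      c.map (localizedModuleFunctor.{u} S) (localizedModuleFunctor_map_smul_id S M x)
    refine ⟨E, hE, fun n hn ↦ h₁ n ((cS _).subsingleton_ext_self hn),
      fun S hS ↦ h₂ S ((cS S).projective_of_projective (M := M.localizedModule S)), ?_, fun h ↦ ?_⟩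
    · intro y hy S hyS
      obtain rfl | hy := List.mem_cons.1 hy
      -- Inverting the head makes the first cone projective, and the later cones preserve this.
      · exact h₂ S ((cS S).projective_of_isUnit (IsLocalization.map_units _ ⟨y, hyS⟩))
      · exact h₃ y hy S hyS
    · have := finite_localizedModule M 𝔪.primeCompl
      have : IsNoetherianRing (Localization 𝔪.primeCompl) :=
        IsLocalization.isNoetherianRing 𝔪.primeCompl _ inferInstance
      refine (cS 𝔪.primeCompl).projectiveDimension_lt_top (M := M.localizedModule 𝔪.primeCompl)
        ?_ (h₄ h)
      change algebraMap R (Localization.AtPrime 𝔪) x ∈ _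
      rw [IsLocalRing.jacobson_eq_maximalIdeal _ bot_ne_top,
        IsLocalization.AtPrime.to_map_mem_maximal_iff _ 𝔪]
      exact hl x List.mem_cons_self

/-- Any localization of `M` is linearly equivalent to `M.localizedModule S`. -/
noncomputable def localizedModuleEquiv (S : Submonoid R) (M : ModuleCat.{u} R) {N : Type*}
    [AddCommGroup N] [Module R N] [Module (Localization S) N] [IsScalarTower R (Localization S) N]
    (f : M →ₗ[R] N) [IsLocalizedModule S f] : M.localizedModule S ≃ₗ[Localization S] N :=
  (IsLocalizedModule.linearEquiv S (M.localizedModuleMkLinearMap S) f).extendScalarsOfIsLocalization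
    S (Localization S)

/-- A finitely generated module over a localization is the localization of a finitely generated
module. -/
theorem exists_localizedModule_iso (S : Submonoid R) (N : ModuleCat.{u} (Localization S))
    [Module.Finite (Localization S) N] :
    ∃ (M : ModuleCat.{u} R) (_ : Module.Finite R M), Nonempty (M.localizedModule S ≅ N) := by
  let : Module R N := Module.compHom N (algebraMap R (Localization S))
  have : IsScalarTower R (Localization S) N := ⟨fun r a y ↦ by
    rw [Algebra.smul_def, mul_smul]; rfl⟩
  obtain ⟨s, hs⟩ := Module.Finite.fg_top (R := Localization S) (M := N)
  let P := Submodule.span R (s : Set N)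
  have hP : IsLocalizedModule S P.subtype :=
    { map_units := fun x ↦ by
        obtain ⟨v, hv⟩ := IsLocalization.map_units (Localization S) x
        rw [Module.End.isUnit_iff]
        convert! MulAction.bijective (β := N) v using 1
        funext y
        rw [Units.smul_def, hv, algebraMap_smul]
        rfl
      surj := fun y ↦ by
        obtain ⟨t, ht⟩ := multiple_mem_span_of_mem_localization_span S (Localization S)
          (s : Set N) y (by rw [hs]; trivial)
        exact ⟨(⟨_, ht⟩, t), rfl⟩
      exists_of_eq := fun h ↦ ⟨1, by rw [Subtype.ext h]⟩ }
  exact ⟨of R P, Module.Finite.iff_fg.2 ⟨s, rfl⟩,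
    ⟨(localizedModuleEquiv S (of R P) P.subtype).toModuleIso⟩⟩

end ModuleCat

/-! ### The two implications -/

open ModuleCat

theorem isTorPersistent_iff_ext : IsTorPersistent R ↔
    ∀ M : ModuleCat.{u} R, Module.Finite R M →
      (∃ n : ℕ, ∀ i : ℕ, n ≤ i → Subsingleton (Ext M M.charDual (i + 1))) →
      projectiveDimension M < ⊤ := by
  refine forall₂_congr fun M _ ↦ imp_congr_left ⟨fun ⟨n, h⟩ ↦ ?_, fun ⟨n, h⟩ ↦ ?_⟩
  · exact ⟨n, fun i hi ↦ (isZero_tor_succ_iff M M i).1 (h (i + 1) (by lia))⟩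
  · refine ⟨n + 1, fun i hi ↦ ?_⟩
    obtain ⟨i, rfl⟩ := Nat.exists_eq_add_of_le' (show 1 ≤ i by lia)
    exact (isZero_tor_succ_iff M M i).2 (h i (by lia))

theorem ModuleCat.isZero_tor_congr {M N : ModuleCat.{u} R} (e : M ≅ N) (i : ℕ) :
    Limits.IsZero (((Tor (ModuleCat.{u} R) i).obj M).obj M) ↔
      Limits.IsZero (((Tor (ModuleCat.{u} R) i).obj N).obj N) :=
  (((Tor (ModuleCat.{u} R) i).obj M).mapIso e ≪≫
    ((Tor (ModuleCat.{u} R) i).mapIso e).app N).isZero_iff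

theorem IsTorPersistent.localization_atPrime [IsNoetherianRing R] (h : IsTorPersistent R)
    (𝔪 : MaximalSpectrum R) : IsTorPersistent (Localization.AtPrime 𝔪.asIdeal) := by
  intro N _ ⟨n, hn⟩
  obtain ⟨M, _, ⟨e⟩⟩ := exists_localizedModule_iso 𝔪.asIdeal.primeCompl N
  obtain ⟨l, hl⟩ := (isNoetherianRing_iff_ideal_fg R).1 inferInstance 𝔪.asIdeal
  obtain ⟨E, hE, h₁, -, h₃, h₄⟩ := exists_iterated_coneKernel 𝔪.asIdeal l.toList
    (fun x hx ↦ hl ▸ Ideal.subset_span (by simpa using hx)) M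
  rw [← projectiveDimension_eq_of_iso e]
  refine h₄ ((projectiveDimension_le_projectiveDimension_of_isLocalizedModule _ E).trans_lt
    (isTorPersistent_iff_ext.1 h E hE ⟨n, fun i hi ↦ ?_⟩))
  -- At `𝔪` the vanishing is inherited from `N`. A maximal `𝔭 ≠ 𝔪` misses some generator of `𝔪`, so
  -- `E` is projective there.
  refine subsingleton_ext_charDual_of_localizedModule E E i fun 𝔭 ↦ ?_
  by_cases hp : 𝔭 = 𝔪
  · subst hp
    exact h₁ n (fun j hj ↦ (isZero_tor_succ_iff _ _ j).1
      ((isZero_tor_congr e _).2 (hn _ (by lia)))) i hi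
  · have : ∃ x ∈ l, x ∉ 𝔭.asIdeal := by
      by_contra! H
      refine hp (MaximalSpectrum.ext ?_)
      refine (𝔪.isMaximal.eq_of_le 𝔭.isMaximal.ne_top ?_).symm
      rw [← hl]
      exact Ideal.span_le.2 H
    obtain ⟨x, hx, hxp⟩ := this
    have := h₃ x (by simpa using hx) 𝔭.asIdeal.primeCompl hxp
    exact subsingleton_ext_of_projective (E.localizedModule _) _ i

theorem IsTorPersistent.of_localization_atPrime [IsNoetherianRing R]
    (h : ∀ 𝔪 : MaximalSpectrum R, IsTorPersistent (Localization.AtPrime 𝔪.asIdeal)) :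
    IsTorPersistent R := by
  rw [isTorPersistent_iff_ext]
  intro M _ ⟨n, hn⟩
  refine M.projectiveDimension_lt_top_of_localizedModule fun 𝔪 ↦ ?_
  exact isTorPersistent_iff_ext.1 (h 𝔪) _ (finite_localizedModule M _)
    ⟨n, fun i hi ↦ subsingleton_ext_charDual_localizedModule _ M M i (hn i hi)⟩

theorem proposition1p4 (R : Type u) [CommRing R] [IsNoetherianRing R] :
    IsTorPersistent R ↔
      ∀ 𝔪 : MaximalSpectrum R, IsTorPersistent (Localization.AtPrime 𝔪.asIdeal) :=
  ⟨IsTorPersistent.localization_atPrime, IsTorPersistent.of_localization_atPrime⟩
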